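/- \textbf{Language.} States are maps $\sigma\in\Sigma=\mathsf{Var}\to\mathsf{Val}$ from a finite set of variables to values (Booleans and rationals). $\mathcal D(\Sigma_\bot)$ is the set of discrete probability distributions on $\Sigma_\bot=\Sigma\cup\{\bot\}$, where $\bot$ stands for divergence; $\mu\sqsubseteq\nu$ means $\mu(\sigma)\le\nu(\sigma)$ for all $\sigma\in\Sigma$; $\uparrow S=\{\nu\mid\exists\mu\in S.\ \mu\sqsubseteq\nu\}$; $\eta(\sigma)=\uparrow\{\delta_\sigma\}$. For $f$ mapping states to sets of distributions, put $f_\bot(\sigma)=f(\sigma)$, $f_\bot(\bot)=\uparrow\{\delta_\bot\}$ and $$f^\dagger(S)=\Big\{\sum_{x\in\operatorname{supp}\mu}\mu(x)\,\nu_x\ \Big|\ \mu\in S,\ \nu_x\in f_\bot(x)\text{ for all }x\in\operatorname{supp}\mu\Big\}.$$ Commands are built from no-op, assignment, sequential composition, nondeterministic choice, probabilistic choice with a rational probability expression, conditionals and while loops. Their denotations $[\![C]\!](\sigma)\subseteq\mathcal D(\Sigma_\bot)$ are: $\eta(\sigma)$ for the no-op; $\eta(\sigma[x:=[\![e]\!](\sigma)])$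 for $x:=e$; $[\![C_2]\!]^\dagger([\![C_1]\!](\sigma))$ for composition; $\{p\mu+(1-p)\nu\mid\mu\in[\![C_1]\!](\sigma),\nu\in[\![C_2]\!](\sigma)\}$ with $p=[\![e]\!](\sigma)$ for probabilistic choice, and the union of these sets over all $p\in[0,1]$ for nondeterministic choice; the chosen branch for a conditional; and for $\mathsf{while}\ e\ \mathsf{do}\ C$ the least fixed point, for pointwise reverse inclusion, of $\Phi(f)(\sigma)=f^\dagger([\![C]\!](\sigma))$ if $[\![e]\!](\sigma)=\mathsf{true}$ and $\Phi(f)(\sigma)=\eta(\sigma)$ otherwise. \textbf{Triples.} For a state predicate $P$, $\mu\vDash\lceil P\rceil$ means $\operatorname{supp}\mu\subseteq\{\sigma\in\Sigma\mid P(\sigma)\}$ (in particular $\mu(\bot)=0$), and $\mu\vDash\varphi\oplus_p\psi$ means $\mu=p\mu_1+(1-p)\mu_2$ for some distributions $\mu_1\vDash\varphi$, $\mu_2\vDash\psi$. The triple $\langle\varphi\rangle C\langle\psi\rangle$ is valid if for every $\mu\vDash\varphi$ every $\nu\in[\![C]\!]^\dagger(\uparrow\{\mu\})$ satisfies $\psi$.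 \textbf{Theorem (Progressing Rank rule).} Let $P$ be a state predicate, $e$ a Boolean expression and $C$ a command. Let $[\![e_{\mathsf{rank}}]\!]:\Sigma\to\mathbb Q_{\ge0}$ be such that, for every state, $e_{\mathsf{rank}}=0$ if and only if $e$ is false, and let $p:\mathbb Q_{\ge0}\to(0,1]$ and $d:\mathbb Q_{\ge0}\to\mathbb Q_{>0}$ be antitone. Suppose that for every $k\in\mathbb Q_{\ge0}$ the triple $$\Big\langle\lceil P\land e\land e_{\mathsf{rank}}=k\rceil\Big\rangle\ C\ \Big\langle\lceil P\land e_{\mathsf{rank}}\le k-d(k)\rceil\oplus_{p(k)}\lceil P\land e_{\mathsf{rank}}\le k+\tfrac{p(k)}{1-p(k)}d(k)\rceil\Big\rangle$$ is valid, where for $p(k)=1$ the bound $k+\frac{p(k)}{1-p(k)}d(k)$ is read as $+\infty$. Then $$\langle\lceil P\rceil\rangle\ \mathsf{while}\ e\ \mathsf{do}\ C\ \langle\lceil P\land\lnot e\rceil\rangle$$ is valid. In particular, $\mathsf{while}\ e\ \mathsf{do}\ C$ terminates almost surely from every state $\sigma$ satisfying $P$: $\mu(\bot)=0$ for all $\mu\in[\![\mathsf{while}\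 e\ \mathsf{do}\ C]\!](\sigma)$. -/

import Mathlib

open scoped ENNReal

noncomputable section

namespace DemonicOL

/-- Program values: Booleans and rational numbers. -/
inductive Val where
  | bool (b : Bool)
  | rat (q : ℚ)

/-- Program states: assignments of values to variables. -/
abbrev State (Var : Type*) := Var → Val

/-- Discrete probability distributions on `X_⊥`; the divergence symbol `⊥` is `none`. -/
abbrev Dist (X : Type*) := PMF (Option X)

section Domain

variable {X Y : Type*}

/-- `μ ⊑ ν`: every proper element is at least as likely under `ν` as under `μ`. -/
def Below (μ ν : Dist X) : Prop :=
  ∀ x : X, μ (some x) ≤ ν (some x)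

/-- The up-closure of a set of distributions. -/
def upClosure (S : Set (Dist X)) : Set (Dist X) :=
  {ν | ∃ μ ∈ S, Below μ ν}

/-- `μ = p · μ₁ + (1 - p) · μ₂`, pointwise. -/
def IsMix (p : unitInterval) (μ μ₁ μ₂ : Dist X) : Prop :=
  ∀ x, μ x = ENNReal.ofReal (p : ℝ) * μ₁ x + ENNReal.ofReal (1 - (p : ℝ)) * μ₂ x

/-- `S ⊕_p T`: all `p · μ₁ + (1 - p) · μ₂` with `μ₁ ∈ S` and `μ₂ ∈ T`. -/
def probChoice (p : unitInterval) (S T : Set (Dist X)) : Set (Dist X) :=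
  {μ | ∃ μ₁ ∈ S, ∃ μ₂ ∈ T, IsMix p μ μ₁ μ₂}

/-- Nondeterministic choice: the union of all `S ⊕_p T`, `p ∈ [0, 1]`. -/
def nondetChoice (S T : Set (Dist X)) : Set (Dist X) :=
  ⋃ p : unitInterval, probChoice p S T

/-- The unit `η(x) = ↑{δ_x}`. -/
def unit (x : X) : Set (Dist X) :=
  upClosure {PMF.pure (some x)}

/-- The extension `f_⊥` of `f` to `X_⊥`, with `f_⊥(⊥) = ↑{δ_⊥}`. -/
def liftBot (f : X → Set (Dist Y)) : Option X → Set (Dist Y)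
  | some x => f x
  | none => upClosure {PMF.pure none}

/-- The Kleisli extension `f†(S)`: all mixtures `∑ₓ μ(x) · ν_x` with `μ ∈ S` and
`ν_x ∈ f_⊥(x)` for every `x` in the support of `μ`. The value of `ν` off the support is irrelevant
to the mixture. -/
def kleisli (f : X → Set (Dist Y)) (S : Set (Dist X)) : Set (Dist Y) :=
  {ξ | ∃ μ ∈ S, ∃ ν : Option X → Dist Y, (∀ x ∈ μ.support, ν x ∈ liftBot f x) ∧ ξ = μ.bind ν}

theorem kleisli_mono {f g : X → Set (Dist Y)} (h : ∀ x, f x ⊆ g x) (S : Set (Dist X)) :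
    kleisli f S ⊆ kleisli g S := by
  rintro ξ ⟨μ, hμ, ν, hν, rfl⟩
  refine ⟨μ, hμ, ν, fun x hx => ?_, rfl⟩
  cases x with
  | none => exact hν none hx
  | some x => exact h x (hν (some x) hx)

/-- The characteristic function `Φ` of the loop with guard `e` and body semantics `S`, as a
monotone map for the pointwise order of *reverse* inclusion (hence the order dual). -/
def loopStep (e : X → Bool) (S : X → Set (Dist X)) :
    (X → (Set (Dist X))ᵒᵈ) →o (X → (Set (Dist X))ᵒᵈ) where
  toFun f x := OrderDual.toDual
    (if e x = true then kleisli (fun y => OrderDual.ofDual (f y)) (S x) else unit x)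
  monotone' := by
    intro f g h x
    show (if e x = true then kleisli (fun y => OrderDual.ofDual (g y)) (S x) else unit x) ⊆
      (if e x = true then kleisli (fun y => OrderDual.ofDual (f y)) (S x) else unit x)
    split
    · exact kleisli_mono (fun y => h y) _
    · exact subset_rfl

end Domain

/-- Commands. Expressions are represented by the functions they denote, which covers every choice
of expression syntax: assigned expressions have arbitrary values, guards are Boolean, and
probability expressions evaluate to rational numbers in `[0, 1]`. -/
inductive Cmd (Var : Type*) where
  | skip
  | assign (x : Var) (e : State Var → Val)
  | seq (C₁ C₂ : Cmd Var)
  | nondet (C₁ C₂ : Cmd Var)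
  | prob (e : State Var → Set.Icc (0 : ℚ) 1) (C₁ C₂ : Cmd Var)
  | cond (e : State Var → Bool) (C₁ C₂ : Cmd Var)
  | loop (e : State Var → Bool) (C : Cmd Var)

/-- A rational probability as a real one. -/
def ratProb (q : Set.Icc (0 : ℚ) 1) : unitInterval :=
  ⟨((q : ℚ) : ℝ), by exact_mod_cast q.2.1, by exact_mod_cast q.2.2⟩

section Logic

variable {Var : Type*}

/-- The denotational semantics of commands. A loop denotes the least fixed point, for reverse
inclusion, of its characteristic function. -/
def sem [DecidableEq Var] : Cmd Var → State Var → Set (Dist (State Var))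
  | .skip, s => unit s
  | .assign x e, s => unit (Function.update s x (e s))
  | .seq C₁ C₂, s => kleisli (sem C₂) (sem C₁ s)
  | .nondet C₁ C₂, s => nondetChoice (sem C₁ s) (sem C₂ s)
  | .prob e C₁ C₂, s => probChoice (ratProb (e s)) (sem C₁ s) (sem C₂ s)
  | .cond e C₁ C₂, s => if e s = true then sem C₁ s else sem C₂ s
  | .loop e C, s => OrderDual.ofDual (OrderHom.lfp (loopStep e (sem C)) s)

/-- Outcome assertions. An atom is represented by the set of states that satisfy it. -/
inductive Assertion (Var : Type*) where
  | top
  | bot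
  | and (φ ψ : Assertion Var)
  | oplus (p : unitInterval) (φ ψ : Assertion Var)
  | nondet (φ ψ : Assertion Var)
  | sure (P : Set (State Var))

/-- Satisfaction of an outcome assertion by a distribution on `Σ_⊥`. -/
def Sat : Dist (State Var) → Assertion Var → Prop
  | _, .top => True
  | _, .bot => False
  | μ, .and φ ψ => Sat μ φ ∧ Sat μ ψ
  | μ, .oplus p φ ψ => ∃ μ₁ μ₂, IsMix p μ μ₁ μ₂ ∧ Sat μ₁ φ ∧ Sat μ₂ ψ
  | μ, .nondet φ ψ => ∃ p : unitInterval, ∃ μ₁ μ₂, IsMix p μ μ₁ μ₂ ∧ Sat μ₁ φ ∧ Sat μ₂ ψ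
  | μ, .sure P => μ.support ⊆ some '' P

/-- Validity of the demonic outcome triple `⟨φ⟩ C ⟨ψ⟩`. -/
def Triple [DecidableEq Var] (φ : Assertion Var) (C : Cmd Var) (ψ : Assertion Var) : Prop :=
  ∀ μ : Dist (State Var), Sat μ φ → ∀ ν ∈ kleisli (sem C) (upClosure {μ}), Sat ν ψ

/-- `C` terminates almost surely from `s`, however nondeterminism is resolved. -/
def AlmostSurelyTerminates [DecidableEq Var] (C : Cmd Var) (s : State Var) : Prop :=
  ∀ μ ∈ sem C s, none ∉ μ.support

end Logic

end DemonicOL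

end

open DemonicOL

/-! Let `B` be an event containing no exit state of `P`. The postcondition of the body makes the
rank a supermartingale: a drop by `δ` with probability `q` pays exactly for a rise by `q / (1 - q) *
δ`. Hence adding `rank / H` to a bound on the probability of `B` charges for the runs that climb to
rank `H`, where the bound exceeds 1 and is trivial.

Below `H`, antitonicity makes progress uniform: each iteration drops the rank by at least `d H` with
probability at least `p H`, so `N ≥ H / d H` drops in a row force an exit. A bound `rank / H + m`
thus improves to `rank / H + (1 - p H ^ N) * m` (`loop_iteration_bound`, `loop_bound_of_rank_le`).
Iterating sends `m` to 0, and then `H → ∞` leaves probability 0 for `B`. -/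

namespace DemonicOL

/-! ### Distributions with divergence and their mixtures -/

section Domain

variable {X Y : Type*}

/-- Above a distribution without divergence there is only that distribution. -/
theorem Below.eq_of_none {μ ν : Dist X} (h : Below μ ν) (hμ : μ none = 0) : ν = μ := by
  have hle : ∀ x, μ x ≤ ν x := by
    rintro (_ | x)
    · simp [hμ]
    · exact h x
  refine (PMF.ext fun x => le_antisymm (hle x) ?_).symm
  -- A strict inequality at one point would give `ν` more total mass than `μ`, but both have mass 1.
  by_contra! hlt
  have := ENNReal.tsum_lt_tsum (by rw [μ.tsum_coe]; exact ENNReal.one_ne_top) hle hlt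
  rw [μ.tsum_coe, ν.tsum_coe] at this
  exact lt_irrefl _ this

theorem upClosure_singleton {μ : Dist X} (hμ : μ none = 0) : upClosure {μ} = {μ} := by
  ext ν
  constructor
  · rintro ⟨_, rfl, h⟩
    exact h.eq_of_none hμ
  · rintro rfl
    exact ⟨ν, rfl, fun _ => le_rfl⟩

theorem unit_eq (x : X) : unit x = {PMF.pure (some x)} :=
  upClosure_singleton (by simp)

/-- Every outcome of `f` at `x` is an outcome of its Kleisli extension at the point mass. -/
theorem mem_kleisli_pure {f : X → Set (Dist Y)} {x : X} {ν : Dist Y} (h : ν ∈ f x) :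
    ν ∈ kleisli f (upClosure {PMF.pure (some x)}) := by
  refine ⟨PMF.pure (some x), ⟨_, rfl, fun _ => le_rfl⟩, fun _ => ν, fun y hy => ?_, ?_⟩
  · obtain rfl : y = some x := by simpa using hy
    exact h
  · simp

theorem toOuterMeasure_le_one {α : Type*} (μ : PMF α) (s : Set α) : μ.toOuterMeasure s ≤ 1 := by
  rw [PMF.toOuterMeasure_apply, ← μ.tsum_coe]
  exact ENNReal.tsum_le_tsum fun x => Set.indicator_le_self' (fun _ _ => zero_le) x

theorem tsum_mul_le_of_support {α : Type*} (μ : PMF α) {g : α → ℝ≥0∞} {c : ℝ≥0∞}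
    (h : ∀ x ∈ μ.support, g x ≤ c) : ∑' x, μ x * g x ≤ c := by
  calc ∑' x, μ x * g x ≤ ∑' x, μ x * c := by
        refine ENNReal.tsum_le_tsum fun x => ?_
        by_cases hx : μ x = 0
        · simp [hx]
        · gcongr
          exact h x ((μ.mem_support_iff x).2 hx)
    _ = c := by rw [ENNReal.tsum_mul_right, μ.tsum_coe, one_mul]

/-- A bound on the expectation under a mixture from bounds on the supports of its parts. -/
theorem IsMix.tsum_mul_le {p : unitInterval} {μ μ₁ μ₂ : Dist X} (h : IsMix p μ μ₁ μ₂)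
    {g : Option X → ℝ≥0∞} {a b : ℝ} (ha : 0 ≤ a)
    (h₁ : ∀ x ∈ μ₁.support, g x ≤ ENNReal.ofReal a)
    (h₂ : p < 1 → ∀ x ∈ μ₂.support, g x ≤ ENNReal.ofReal b) (hb : 0 ≤ b) :
    ∑' x, μ x * g x ≤ ENNReal.ofReal (p * a + (1 - p) * b) := by
  have hp := p.2.1
  have hp' : 0 ≤ 1 - (p : ℝ) := sub_nonneg.2 p.2.2
  have hsplit : ∑' x, μ x * g x = ENNReal.ofReal p * ∑' x, μ₁ x * g x +
      ENNReal.ofReal (1 - p) * ∑' x, μ₂ x * g x := by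
    rw [← ENNReal.tsum_mul_left, ← ENNReal.tsum_mul_left, ← ENNReal.tsum_add]
    refine tsum_congr fun x => ?_
    rw [h x]
    ring
  rw [hsplit, ENNReal.ofReal_add (by positivity) (by positivity), ENNReal.ofReal_mul hp,
    ENNReal.ofReal_mul hp']
  refine add_le_add (by gcongr; exact tsum_mul_le_of_support _ h₁) ?_
  -- For `p = 1` the second part has weight 0, so no bound on it is needed.
  rcases lt_or_eq_of_le (show p ≤ 1 from p.2.2) with hlt | rfl
  · gcongr
    exact tsum_mul_le_of_support _ (h₂ hlt)
  · simp

theorem IsMix.support_left {p : unitInterval} {μ μ₁ μ₂ : Dist X} (h : IsMix p μ μ₁ μ₂)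
    (hp : 0 < p) : μ₁.support ⊆ μ.support := by
  intro x hx
  rw [PMF.mem_support_iff] at hx ⊢
  have hp' : (0 : ℝ) < p := hp
  rw [h x]
  simp [hx, hp']

theorem IsMix.support_right {p : unitInterval} {μ μ₁ μ₂ : Dist X} (h : IsMix p μ μ₁ μ₂)
    (hp : p < 1) : μ₂.support ⊆ μ.support := by
  intro x hx
  rw [PMF.mem_support_iff] at hx ⊢
  have hp' : (p : ℝ) < 1 := hp
  rw [h x]
  simp [hx, hp']

end Domain

/-! ### Loop unfolding and reduction of triples to single states -/

section Logic

variable {Var : Type*} [DecidableEq Var]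

/-- This fixed-point equation is all that is used about the loop; extremality of the fixed point
plays no role. -/
theorem sem_loop (e : State Var → Bool) (C : Cmd Var) (s : State Var) :
    sem (.loop e C) s = if e s = true then kleisli (sem (.loop e C)) (sem C s) else unit s :=
  (congrArg OrderDual.ofDual (congrFun (OrderHom.map_lfp (loopStep e (sem C))) s)).symm

theorem Triple.sat_of_mem_sem {Q : Set (State Var)} {C : Cmd Var} {ψ : Assertion Var}
    (h : Triple (.sure Q) C ψ) {s : State Var} (hs : s ∈ Q) {ν : Dist (State Var)}
    (hν : ν ∈ sem C s) : Sat ν ψ :=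
  h (PMF.pure (some s)) (by simpa [Sat] using hs) ν (mem_kleisli_pure hν)

/-- A triple with a state predicate as precondition may be checked state by state. -/
theorem triple_sure_of_forall {P Q : Set (State Var)} {C : Cmd Var}
    (h : ∀ s ∈ P, ∀ ν ∈ sem C s, Sat ν (.sure Q)) : Triple (.sure P) C (.sure Q) := by
  intro μ hμ ν hν
  have hnone : μ none = 0 := by
    by_contra hne
    obtain ⟨s, -, hs⟩ := hμ ((μ.mem_support_iff none).2 hne)
    cases hs
  -- The precondition excludes divergence, so the up-closure adds nothing.
  rw [upClosure_singleton hnone] at hν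
  obtain ⟨_, rfl, κ, hκ, rfl⟩ := hν
  intro y hy
  obtain ⟨x, hx, hxy⟩ := (PMF.mem_support_bind_iff _ _ _).1 hy
  obtain ⟨s, hs, rfl⟩ := hμ hx
  exact h s hs _ (hκ _ hx) hxy

/-! ### Rank bounds on the probability of bad outcomes -/

section Rank

variable {P : Set (State Var)} {e : State Var → Bool} {C : Cmd Var}
  {rank : State Var → ℚ≥0} {p : ℚ≥0 → unitInterval} {d : ℚ≥0 → ℚ≥0}

/-- One loop iteration: an affine bound on the probability of `B` in the ranks, with offset `a`
for the states of rank at most `k - d k` and offset `m` elsewhere, is averaged by the body. -/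
theorem loop_iteration_bound (hp_pos : ∀ k, 0 < p k)
    (hC : ∀ k : ℚ≥0,
      Triple (.sure {s | s ∈ P ∧ e s = true ∧ rank s = k}) C
        (.oplus (p k)
          (.sure {s | s ∈ P ∧ (rank s : ℝ) ≤ (k : ℝ) - (d k : ℝ)})
          (.sure {s | s ∈ P ∧ (p k < 1 →
            (rank s : ℝ) ≤ (k : ℝ) + (p k : ℝ) / (1 - (p k : ℝ)) * (d k : ℝ))})))
    {B : Set (Option (State Var))} {H a m : ℝ} (hH : 0 < H) (ha : 0 ≤ a) (hm : 0 ≤ m)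
    {s : State Var} (hs : s ∈ P) (hes : e s = true)
    (hlow : ∀ t ∈ P, (rank t : ℝ) ≤ (rank s : ℝ) - (d (rank s) : ℝ) → ∀ ν ∈ sem (.loop e C) t,
      ν.toOuterMeasure B ≤ ENNReal.ofReal (rank t / H + a))
    (hall : ∀ t ∈ P, ∀ ν ∈ sem (.loop e C) t,
      ν.toOuterMeasure B ≤ ENNReal.ofReal (rank t / H + m))
    {ν : Dist (State Var)} (hν : ν ∈ sem (.loop e C) s) :
    ν.toOuterMeasure B ≤
      ENNReal.ofReal (rank s / H + (p (rank s) * a + (1 - p (rank s)) * m)) := by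
  rw [sem_loop, if_pos hes] at hν
  obtain ⟨μ, hμ, κ, hκ, rfl⟩ := hν
  obtain ⟨μ₁, μ₂, hmix, h₁, h₂⟩ := (hC (rank s)).sat_of_mem_sem ⟨hs, hes, rfl⟩ hμ
  simp only [Sat] at h₁ h₂
  set k := rank s
  obtain ⟨q, hq⟩ : ∃ q : ℝ, q = p k := ⟨_, rfl⟩
  set δ : ℝ := (d k : ℝ)
  have hδ : 0 ≤ δ := by positivity
  have hq0 : 0 < q := hq ▸ hp_pos k
  have hq1 : 0 ≤ 1 - q := hq ▸ sub_nonneg.2 (p k).2.2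
  -- Some outcome in the support of `μ₁` has rank at most `k - δ`, and ranks are nonnegative.
  have hkδ : 0 ≤ (k : ℝ) - δ := by
    obtain ⟨x, hx⟩ := μ₁.support_nonempty
    obtain ⟨t, ⟨-, ht⟩, rfl⟩ := h₁ hx
    exact le_trans (by positivity) ht
  rw [PMF.toOuterMeasure_bind_apply]
  -- For `q = 1` the quotient `q / (1 - q)` is 0 by convention, which is harmless because that
  -- branch has weight 0.
  refine (hmix.tsum_mul_le (a := (k - δ) / H + a) (b := (k + q / (1 - q) * δ) / H + m)
    (by positivity) ?_ ?_ (by positivity)).trans (ENNReal.ofReal_le_ofReal ?_)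
  · intro x hx
    have hxμ := hmix.support_left (hp_pos k) hx
    obtain ⟨t, ⟨htP, ht⟩, rfl⟩ := h₁ hx
    refine (hlow t htP ht _ (hκ _ hxμ)).trans (ENNReal.ofReal_le_ofReal ?_)
    gcongr
  · intro hlt x hx
    have hxμ := hmix.support_right hlt hx
    obtain ⟨t, ⟨htP, ht⟩, rfl⟩ := h₂ hx
    refine (hall t htP _ (hκ _ hxμ)).trans (ENNReal.ofReal_le_ofReal ?_)
    gcongr
    exact hq ▸ ht hlt
  · rw [← hq]
    -- For `q = 1` only the drop remains; otherwise drop and rise cancel, and the averaged bound is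
    -- an equality.
    rcases hq1.eq_or_lt with h | h
    · have hq' : q = 1 := by linarith
      rw [hq']
      have : ((k : ℝ) - δ) / H ≤ k / H := by gcongr; linarith
      linarith
    · refine le_of_eq ?_
      field_simp
      ring

variable (hrank : ∀ s, e s = false ↔ rank s = 0)
    (hp_pos : ∀ k, 0 < p k) (hp_anti : Antitone p) (hd_anti : Antitone d)
    (hC : ∀ k : ℚ≥0,
      Triple (.sure {s | s ∈ P ∧ e s = true ∧ rank s = k}) C
        (.oplus (p k)
          (.sure {s | s ∈ P ∧ (rank s : ℝ) ≤ (k : ℝ) - (d k : ℝ)})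
          (.sure {s | s ∈ P ∧ (p k < 1 →
            (rank s : ℝ) ≤ (k : ℝ) + (p k : ℝ) / (1 - (p k : ℝ)) * (d k : ℝ))})))
    {B : Set (Option (State Var))} (hB : ∀ s ∈ P, e s = false → some s ∉ B)

include hrank hp_pos hp_anti hd_anti hC hB

/-- A bound `rank / H + m` improves to `rank / H + (1 - p(H) ^ n) * m` for ranks up to `n * d(H)`. -/
theorem loop_bound_of_rank_le {H : ℚ≥0} (hH : 0 < H) {m : ℝ} (hm : 0 ≤ m)
    (hall : ∀ t ∈ P, ∀ ν ∈ sem (.loop e C) t,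
      ν.toOuterMeasure B ≤ ENNReal.ofReal (rank t / H + m)) (n : ℕ) :
    ∀ s ∈ P, (rank s : ℝ) ≤ n * d H → ∀ ν ∈ sem (.loop e C) s,
      ν.toOuterMeasure B ≤ ENNReal.ofReal (rank s / H + (1 - (p H : ℝ) ^ n) * m) := by
  have hHR : (0 : ℝ) < H := by exact_mod_cast hH
  have hexit : ∀ s ∈ P, e s = false → ∀ ν ∈ sem (.loop e C) s, ν.toOuterMeasure B = 0 := by
    intro s hs hes ν hν
    rw [sem_loop, if_neg (by simp [hes]), unit_eq] at hν
    obtain rfl := hν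
    rw [PMF.toOuterMeasure_pure_apply, if_neg (hB s hs hes)]
  induction n with
  | zero =>
    intro s hs hr ν hν
    have h0 : rank s = 0 := by
      have : (rank s : ℝ) ≤ 0 := by simpa using hr
      exact le_antisymm (by exact_mod_cast this) (zero_le)
    rw [hexit s hs ((hrank s).2 h0) ν hν]
    exact zero_le
  | succ n ih =>
    intro s hs hr ν hν
    have hq0 : (0 : ℝ) ≤ p H := (p H).2.1
    have hq1 : (p H : ℝ) ≤ 1 := (p H).2.2
    have hpow : ∀ j, 0 ≤ (1 - (p H : ℝ) ^ j) * m := fun j =>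
      mul_nonneg (sub_nonneg.2 (pow_le_one₀ hq0 hq1)) hm
    -- At rank `H` or more the term `rank / H` alone is at least 1; below, `d` and `p` are bounded
    -- below by their values at `H`.
    rcases le_total H (rank s) with hHs | hHs
    · have h1 : (1 : ℝ) ≤ rank s / H := by
        rw [one_le_div hHR]
        exact_mod_cast hHs
      refine (toOuterMeasure_le_one ν B).trans ?_
      rw [ENNReal.one_le_ofReal]
      linarith [hpow (n + 1)]
    · cases hes : e s with
      | false =>
        rw [hexit s hs hes ν hν]
        exact zero_le
      | true =>
        have hd : (d H : ℝ) ≤ d (rank s) := by exact_mod_cast hd_anti hHs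
        have hp : (p H : ℝ) ≤ p (rank s) := hp_anti hHs
        refine (loop_iteration_bound hp_pos hC hHR (hpow n) hm hs hes ?_ hall hν).trans
          (ENNReal.ofReal_le_ofReal ?_)
        · intro t ht htr
          refine ih t ht ?_
          push_cast at hr
          linarith
        · rw [pow_succ]
          -- With `p'` the probability at `rank s` and `q` that at `H`, the averaged offset is `(1 -
          -- p' * q ^ n) * m`, and `q ≤ p'`.
          nlinarith [mul_nonneg (mul_nonneg (sub_nonneg.2 hp) (pow_nonneg hq0 n)) hm]

/-- The outcomes of the loop from `P` avoid every event that excludes the exit states in `P`. -/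
theorem loop_toOuterMeasure_eq_zero (hd_pos : ∀ k, 0 < d k) {s : State Var} (hs : s ∈ P)
    {ν : Dist (State Var)} (hν : ν ∈ sem (.loop e C) s) : ν.toOuterMeasure B = 0 := by
  have hbound : ∀ H : ℚ≥0, 0 < H → ν.toOuterMeasure B ≤ ENNReal.ofReal (rank s / H) := by
    intro H hH
    have hHR : (0 : ℝ) < H := by exact_mod_cast hH
    have hq0 : (0 : ℝ) < p H := hp_pos H
    have hq1 : (p H : ℝ) ≤ 1 := (p H).2.2
    have hdH : (0 : ℝ) < d H := by exact_mod_cast hd_pos H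
    -- `N` drops of size `d H` cover every rank up to `H`.
    obtain ⟨N, hN⟩ := exists_nat_ge ((H : ℝ) / d H)
    rw [div_le_iff₀ hdH] at hN
    set c : ℝ := 1 - (p H : ℝ) ^ N with hc
    have hc0 : 0 ≤ c := sub_nonneg.2 (pow_le_one₀ hq0.le hq1)
    have hc1 : c < 1 := by linarith [pow_pos hq0 N]
    have hiter : ∀ j : ℕ, ∀ t ∈ P, ∀ ν ∈ sem (.loop e C) t,
        ν.toOuterMeasure B ≤ ENNReal.ofReal (rank t / H + c ^ j) := by
      intro j
      induction j with
      | zero =>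
        intro t _ ν _
        refine (toOuterMeasure_le_one ν B).trans ?_
        rw [ENNReal.one_le_ofReal, pow_zero]
        linarith [show (0 : ℝ) ≤ rank t / H by positivity]
      | succ j ih =>
        intro t ht ν hν
        rcases le_total H (rank t) with hHt | hHt
        · refine (toOuterMeasure_le_one ν B).trans ?_
          have h1 : (1 : ℝ) ≤ rank t / H := by
            rw [one_le_div hHR]
            exact_mod_cast hHt
          rw [ENNReal.one_le_ofReal]
          linarith [pow_nonneg hc0 (j + 1)]
        · have hHt' : (rank t : ℝ) ≤ H := by exact_mod_cast hHt
          rw [pow_succ']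
          exact loop_bound_of_rank_le hrank hp_pos hp_anti hd_anti hC hB hH (pow_nonneg hc0 j) ih
            N t ht (hHt'.trans hN) ν hν
    have hlim : Filter.Tendsto (fun j : ℕ => ENNReal.ofReal (rank s / H + c ^ j)) Filter.atTop
        (nhds (ENNReal.ofReal (rank s / H + 0))) :=
      (ENNReal.continuous_ofReal.tendsto _).comp
        ((tendsto_pow_atTop_nhds_zero_of_lt_one hc0 hc1).const_add _)
    rw [add_zero] at hlim
    exact ge_of_tendsto' hlim fun j => hiter j s hs ν hν
  -- Let `H = n + 1` tend to infinity; the shift keeps `H` positive.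
  have hlim : Filter.Tendsto (fun n : ℕ => ENNReal.ofReal (rank s / ((n + 1 : ℕ) : ℝ)))
      Filter.atTop (nhds (ENNReal.ofReal 0)) :=
    (ENNReal.continuous_ofReal.tendsto _).comp
      ((tendsto_const_div_atTop_nhds_zero_nat _).comp (Filter.tendsto_add_atTop_nat 1))
  rw [ENNReal.ofReal_zero] at hlim
  refine le_antisymm (ge_of_tendsto' hlim fun n => ?_) (zero_le)
  simpa using hbound ((n + 1 : ℕ) : ℚ≥0) (by positivity)

end Rank

end Logic

end DemonicOL

theorem mainTheorem5 {Var : Type*} [Finite Var] [DecidableEq Var]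
    (P : Set (State Var)) (e : State Var → Bool) (C : Cmd Var)
    (rank : State Var → ℚ≥0) (p : ℚ≥0 → unitInterval) (d : ℚ≥0 → ℚ≥0)
    (hrank : ∀ s, e s = false ↔ rank s = 0)
    (hp_pos : ∀ k, 0 < p k) (hp_anti : Antitone p)
    (hd_pos : ∀ k, 0 < d k) (hd_anti : Antitone d)
    (hC : ∀ k : ℚ≥0,
      Triple (.sure {s | s ∈ P ∧ e s = true ∧ rank s = k}) C
        (.oplus (p k)
          (.sure {s | s ∈ P ∧ (rank s : ℝ) ≤ (k : ℝ) - (d k : ℝ)})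
          (.sure {s | s ∈ P ∧ (p k < 1 →
            (rank s : ℝ) ≤ (k : ℝ) + (p k : ℝ) / (1 - (p k : ℝ)) * (d k : ℝ))}))) :
    Triple (.sure P) (.loop e C) (.sure {s | s ∈ P ∧ e s = false}) ∧
      ∀ s ∈ P, AlmostSurelyTerminates (.loop e C) s := by
  have hsafe : ∀ s ∈ P, ∀ ν ∈ sem (.loop e C) s,
      Sat ν (.sure {s | s ∈ P ∧ e s = false}) := by
    intro s hs ν hν
    -- This complement contains `⊥` as well as every bad state, so one null event settles both the
    -- postcondition and termination.
    have h0 := loop_toOuterMeasure_eq_zero (B := (some '' {s | s ∈ P ∧ e s = false})ᶜ)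
      hrank hp_pos hp_anti hd_anti hC
      (fun t ht het hmem => hmem ⟨t, ⟨ht, het⟩, rfl⟩) hd_pos hs hν
    rw [PMF.toOuterMeasure_apply_eq_zero_iff, Set.disjoint_compl_right_iff_subset] at h0
    exact h0
  refine ⟨triple_sure_of_forall hsafe, fun s hs ν hν hnone => ?_⟩
  obtain ⟨t, -, ht⟩ := hsafe s hs ν hν hnone
  cases ht
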